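/- Let $n$ be a natural number, let $A\in\mathbb R^{n\times n}$ be symmetric, and let $a,b\in\mathbb R^n$, $\beta\in\mathbb R$. Consider the extended trust region subproblem $$\text{(eTRS)}\qquad \min\ x^{T}Ax+2a^{T}x\quad\text{subject to}\quad \|x\|^2\le 1,\ \ b^{T}x\le\beta,\quad x\in\mathbb R^n,$$ where $\|\cdot\|$ is the Euclidean norm, and let $L_{n+1}=\{(x_0;\bar x)\in\mathbb R\times\mathbb R^n : \|\bar x\|\le x_0\}$ be the Lorentz cone. Suppose that there is $\hat x\in\mathbb R^n$ with $\|\hat x\|^2-1<0$ and $b^{T}\hat x-\beta<0$, and let $x^*$ be a feasible point of (eTRS). Then $x^*$ is a global minimizer of (eTRS) if and only if there exist $\lambda_0\ge 0$, $u_0\in\mathbb R$ and $u\in\mathbb R^n$ with $(-u_0;u)\in L_{n+1}$ such that (i) $(2A+2\lambda_0 I+bu^{T}+ub^{T})x^*=-(2a-\beta u-u_0b)$; (ii) $\lambda_0(\|x^*\|^2-1)=0$ and $(u^{T}x^*-u_0)(b^{T}x^*-\beta)=0$; (iii) $2A+2\lambda_0 I+bu^{T}+ub^{T}$ is positive semidefinite.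 -/

import Mathlib

open scoped Matrix

/-- The Euclidean norm of a vector of `ℝⁿ` written as a plain tuple. -/
noncomputable def euclNorm {n : ℕ} (x : Fin n → ℝ) : ℝ := ‖WithLp.toLp 2 x‖

/-- The Lorentz (second-order) cone `{(x₀; x̄) ∈ ℝⁿ⁺¹ : ‖x̄‖ ≤ x₀}`. The entry with index `0`
is `x₀`, and `Fin.tail` is the vector `x̄` of the other `n` entries. -/
def lorentzCone (n : ℕ) : Set (Fin (n + 1) → ℝ) :=
  {z | euclNorm (Fin.tail z) ≤ z 0}

/-- The objective function `xᵀ A x + 2 aᵀ x`. -/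
def etrsObjective {n : ℕ} (A : Matrix (Fin n) (Fin n) ℝ) (a : Fin n → ℝ) (x : Fin n → ℝ) : ℝ :=
  x ⬝ᵥ (A *ᵥ x) + 2 * (a ⬝ᵥ x)

/-- The feasible set `{x : ‖x‖² ≤ 1, bᵀ x ≤ β}`. -/
def etrsFeasible {n : ℕ} (b : Fin n → ℝ) (β : ℝ) : Set (Fin n → ℝ) :=
  {x | euclNorm x ^ 2 ≤ 1 ∧ b ⬝ᵥ x ≤ β}

/-- The matrix `2 A + 2 λ₀ I + b uᵀ + u bᵀ`. -/
def etrsHessian {n : ℕ} (A : Matrix (Fin n) (Fin n) ℝ) (b : Fin n → ℝ) (lam₀ : ℝ)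
    (u : Fin n → ℝ) : Matrix (Fin n) (Fin n) ℝ :=
  (2 : ℝ) • A + (2 * lam₀) • (1 : Matrix (Fin n) (Fin n) ℝ)
    + Matrix.vecMulVec b u + Matrix.vecMulVec u b

/-!
The easy direction is weak duality: on the feasible set the Lagrangian `etrsLagrangian`, in which
the linear constraint carries the affine multiplier `uᵀ x - u₀ ≥ 0`, lies below the objective, and
the stationarity and semidefiniteness conditions say that it is a convex quadratic function with a
critical point at `xstar`, where by complementary slackness it agrees with the objective.

Conversely, minimality of `xstar` says, after homogenization, that a quadratic form `Q` on
`ℝ × ℝⁿ` is nonnegative on the Lorentz cone cut by a half-space `0 ≤ h`. What has to be shown is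
that `Q` dominates `lam * J + h * W` everywhere, where `J = t² - ‖x‖²`, `0 ≤ lam`, and `W` is a
functional in the (self-dual) Lorentz cone (`exists_lorentz_certificate`). This takes two steps.

* `exists_lorentz_multiplier`: if `q` is in the open cone with `0 ≤ h q`, and `z` is spacelike with
  `h z = 0`, then the line through `q` with direction `z` leaves the cone at two points, at which
  `Q` is nonnegative. A suitable average of these two values gives `Q z / J z ≤ Q q / J q`. Hence
  the supremum of the left-hand sides, together with zero, is a multiplier `lam` for which
  `Q - lam * J` is nonnegative both on the cut cone and on the kernel of `h`.
* `exists_dual_functional`: the form `R = Q - lam * J` is then convex on the hyperplane `h = 1`, so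
  its epigraph over that hyperplane can be separated from the product of the negative reals and
  the open cone. The Slater point makes the separation nonvertical, and it yields `W ≤ R` on
  `h = 1`, which is `h * W ≤ R` by homogeneity.

The slice `t = 1` of the certificate bounds the Lagrangian from below by the minimum, which gives
stationarity and complementary slackness, and the slice `t = 0` gives semidefiniteness.
-/

/-! ### Quadratic forms nonnegative on a section of the Lorentz cone -/

section Lorentz

variable {E : Type*} [NormedAddCommGroup E] [InnerProductSpace ℝ E]

/-- The Lorentz form `(t, x) ↦ t² - ‖x‖²` on `ℝ × E`. -/
noncomputable def lorentzForm (E : Type*) [NormedAddCommGroup E] [InnerProductSpace ℝ E] :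
    QuadraticForm ℝ (ℝ × E) :=
  QuadraticMap.sq.comp (LinearMap.fst ℝ ℝ E) -
    (LinearMap.BilinMap.toQuadraticMap (innerₗ E)).comp (LinearMap.snd ℝ ℝ E)

theorem lorentzForm_apply (z : ℝ × E) : lorentzForm E z = z.1 ^ 2 - ‖z.2‖ ^ 2 := by
  simp [lorentzForm, sq]

theorem lorentzForm_nonneg_iff {z : ℝ × E} : 0 ≤ lorentzForm E z ↔ ‖z.2‖ ≤ |z.1| := by
  rw [lorentzForm_apply, sub_nonneg, sq_le_sq, abs_norm]

theorem lorentzForm_pos_iff {z : ℝ × E} : 0 < lorentzForm E z ↔ ‖z.2‖ < |z.1| := by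
  rw [lorentzForm_apply, sub_pos, sq_lt_sq, abs_norm]

theorem quadraticForm_add_smul {V : Type*} [AddCommGroup V] [Module ℝ V]
    (Q : QuadraticForm ℝ V) (x y : V) (c : ℝ) :
    Q (x + c • y) = Q x + c * QuadraticMap.polar Q x y + c ^ 2 * Q y := by
  rw [QuadraticMap.map_add Q, QuadraticMap.map_smul, QuadraticMap.polar_smul_right]
  simp only [smul_eq_mul]
  ring

/-- If a quadratic polynomial is nonnegative at both roots of another one whose constant and
leading coefficients have opposite signs, then the coefficients satisfy a linear inequality:
a suitable average of the two values cancels the linear term. -/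
theorem mul_le_mul_of_nonneg_at_roots {j₀ j₁ j₂ q₀ q₁ q₂ : ℝ} (hj₀ : 0 < j₀) (hj₂ : j₂ < 0)
    (h : ∀ c : ℝ, j₀ + c * j₁ + c ^ 2 * j₂ = 0 → 0 ≤ q₀ + c * q₁ + c ^ 2 * q₂) :
    q₀ * j₂ ≤ q₂ * j₀ := by
  set r := √(j₁ ^ 2 - 4 * j₀ * j₂)
  have hpos : 0 < -(j₀ * j₂) := by nlinarith
  have hr : r ^ 2 = j₁ ^ 2 - 4 * j₀ * j₂ := Real.sq_sqrt (by nlinarith [sq_nonneg j₁])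
  have hlt : |j₁| < r := by
    rw [← Real.sqrt_sq_eq_abs]
    exact Real.sqrt_lt_sqrt (sq_nonneg _) (by nlinarith)
  obtain ⟨h1, h2⟩ := abs_lt.mp hlt
  have hj : j₂ ≠ 0 := hj₂.ne
  have e1 := h ((-j₁ - r) / (2 * j₂)) (by field_simp; nlinarith)
  have e2 := h ((-j₁ + r) / (2 * j₂)) (by field_simp; nlinarith)
  have hr0 : 0 < r := (abs_nonneg _).trans_lt hlt
  have hc1 : 0 ≤ r - j₁ := by linarith
  have hc2 : 0 ≤ r + j₁ := by linarith
  -- The weights are proportional to the absolute values of the opposite roots.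
  have key := add_nonneg (mul_nonneg hc1 e1) (mul_nonneg hc2 e2)
  have hid : (r - j₁) * (q₀ + (-j₁ - r) / (2 * j₂) * q₁ + ((-j₁ - r) / (2 * j₂)) ^ 2 * q₂)
      + (r + j₁) * (q₀ + (-j₁ + r) / (2 * j₂) * q₁ + ((-j₁ + r) / (2 * j₂)) ^ 2 * q₂)
      = 2 * r * (q₀ + (r ^ 2 - j₁ ^ 2) / (4 * j₂ ^ 2) * q₂) := by
    field_simp
    ring
  rw [hid] at key
  have h3 : 0 ≤ q₀ + (r ^ 2 - j₁ ^ 2) / (4 * j₂ ^ 2) * q₂ :=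
    nonneg_of_mul_nonneg_right key (by positivity)
  have h4 : (r ^ 2 - j₁ ^ 2) / (4 * j₂ ^ 2) = -j₀ / j₂ := by
    rw [hr]; field_simp; ring
  rw [h4] at h3
  have h5 : (q₀ + -j₀ / j₂ * q₂) * j₂ = q₀ * j₂ - q₂ * j₀ := by
    field_simp
    ring
  nlinarith [mul_nonneg_of_nonpos_of_nonpos (neg_nonpos.mpr h3) hj₂.le]

/-- A line through a point `q` of the open Lorentz cone in a spacelike direction `z` meets
the boundary of the double cone only in the forward cone. -/
theorem norm_le_of_lorentzForm_add_smul {q z : ℝ × E} (hq : ‖q.2‖ < q.1)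
    (hz : lorentzForm E z < 0) {c : ℝ} (hc : lorentzForm E (q + c • z) = 0) :
    ‖(q + c • z).2‖ ≤ (q + c • z).1 := by
  have hy := lorentzForm_nonneg_iff.mp hc.ge
  rcases le_or_gt 0 (q + c • z).1 with h | h
  · rwa [abs_of_nonneg h] at hy
  exfalso
  set y := q + c • z with hy_def
  rw [abs_of_neg h] at hy
  have hcz : y - q = c • z := by simp [hy_def]
  -- `q` and `-y` lie in the same cone, so `y - q` would be timelike.
  have h1 : lorentzForm E (y - q) ≤ 0 := by
    rw [hcz, QuadraticMap.map_smul, smul_eq_mul]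
    exact mul_nonpos_of_nonneg_of_nonpos (mul_self_nonneg c) hz.le
  have h2 : 0 < lorentzForm E (y - q) := by
    rw [lorentzForm_pos_iff]
    calc ‖(y - q).2‖ ≤ ‖y.2‖ + ‖q.2‖ := norm_sub_le _ _
      _ < -(y.1 - q.1) := by linarith
      _ ≤ |(y - q).1| := neg_le_abs _
  exact absurd h1 h2.not_ge

/-- The S-lemma on a half of the Lorentz cone: the multiplier of the Lorentz form can be chosen
uniformly over the cut open cone and the cutting hyperplane. -/
theorem exists_lorentz_multiplier (Q : QuadraticForm ℝ (ℝ × E)) (h : ℝ × E →ₗ[ℝ] ℝ)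
    (hQ : ∀ z : ℝ × E, ‖z.2‖ ≤ z.1 → 0 ≤ h z → 0 ≤ Q z)
    {z₀ : ℝ × E} (hz₀ : ‖z₀.2‖ < z₀.1) (hhz₀ : 0 ≤ h z₀) :
    ∃ lam : ℝ, 0 ≤ lam ∧
      (∀ z : ℝ × E, ‖z.2‖ < z.1 → 0 ≤ h z → lam * lorentzForm E z ≤ Q z) ∧
      ∀ z : ℝ × E, h z = 0 → lam * lorentzForm E z ≤ Q z := by
  have hJ : ∀ q : ℝ × E, ‖q.2‖ < q.1 → 0 < lorentzForm E q := fun q hq =>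
    lorentzForm_pos_iff.mpr (hq.trans_le (le_abs_self _))
  have hpair : ∀ q z : ℝ × E, ‖q.2‖ < q.1 → 0 ≤ h q → h z = 0 → lorentzForm E z < 0 →
      Q z / lorentzForm E z ≤ Q q / lorentzForm E q := by
    intro q z hq hhq hhz hz
    have hmul := mul_le_mul_of_nonneg_at_roots (q₁ := QuadraticMap.polar Q q z) (q₀ := Q q)
      (q₂ := Q z) (j₁ := QuadraticMap.polar (lorentzForm E) q z) (hJ q hq) hz ?_
    · rw [le_div_iff₀ (hJ q hq), div_mul_eq_mul_div, div_le_iff_of_neg hz]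
      exact hmul
    · intro c hc
      rw [← quadraticForm_add_smul] at hc ⊢
      exact hQ _ (norm_le_of_lorentzForm_add_smul hq hz hc) (by simp [hhz, hhq])
  -- Zero is inserted to make the multiplier nonnegative and the set nonempty.
  let S : Set ℝ := insert 0 {r | ∃ z : ℝ × E, h z = 0 ∧ lorentzForm E z < 0 ∧
    Q z / lorentzForm E z = r}
  have hub : ∀ q : ℝ × E, ‖q.2‖ < q.1 → 0 ≤ h q → Q q / lorentzForm E q ∈ upperBounds S := by
    rintro q hq hhq r (rfl | ⟨z, hz, hzJ, rfl⟩)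
    · exact div_nonneg (hQ q hq.le hhq) (hJ q hq).le
    · exact hpair q z hq hhq hz hzJ
  have hS : BddAbove S := ⟨_, hub z₀ hz₀ hhz₀⟩
  have hcone : ∀ z : ℝ × E, ‖z.2‖ < z.1 → 0 ≤ h z → sSup S * lorentzForm E z ≤ Q z :=
    fun z hz hhz => (le_div_iff₀ (hJ z hz)).mp
      (csSup_le (Set.insert_nonempty _ _) (hub z hz hhz))
  refine ⟨sSup S, le_csSup hS (Set.mem_insert _ _), hcone, fun z hz => ?_⟩
  rcases lt_trichotomy (lorentzForm E z) 0 with hzJ | hzJ | hzJ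
  · exact (div_le_iff_of_neg hzJ).mp (le_csSup hS (Set.mem_insert_of_mem _ ⟨z, hz, hzJ, rfl⟩))
  · rw [hzJ, mul_zero]
    have hn := lorentzForm_nonneg_iff.mp hzJ.ge
    rcases abs_cases z.1 with ⟨h1, -⟩ | ⟨h1, -⟩
    · exact hQ z (h1 ▸ hn) hz.ge
    · rw [← QuadraticMap.map_neg]
      exact hQ (-z) (by simpa [h1] using hn) (by simp [hz])
  · have hn := lorentzForm_pos_iff.mp hzJ
    rcases abs_cases z.1 with ⟨h1, -⟩ | ⟨h1, -⟩
    · exact hcone z (h1 ▸ hn) hz.ge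
    · rw [← QuadraticMap.map_neg, ← QuadraticMap.map_neg Q]
      exact hcone (-z) (by simpa [h1] using hn) (by simp [hz])

theorem convex_openLorentzCone : Convex ℝ {z : ℝ × E | ‖z.2‖ < z.1} := by
  have h : ConvexOn ℝ Set.univ fun z : ℝ × E => ‖z.2‖ - z.1 :=
    ((convexOn_univ_norm (E := E)).comp_linearMap (LinearMap.snd ℝ ℝ E)).sub
      ((LinearMap.fst ℝ ℝ E).concaveOn convex_univ)
  simpa using h.convex_lt 0

/-- A quadratic form that is nonnegative on the kernel of a functional is convex on the parallel
hyperplanes. -/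
theorem convex_epigraph_of_nonneg_on_ker {V : Type*} [AddCommGroup V] [Module ℝ V]
    (R : QuadraticForm ℝ V) (h : V →ₗ[ℝ] ℝ) (hR : ∀ z, h z = 0 → 0 ≤ R z) (d : ℝ) :
    Convex ℝ {p : ℝ × V | h p.2 = d ∧ R p.2 ≤ p.1} := by
  rintro ⟨s, x⟩ ⟨hx, hxs⟩ ⟨r, y⟩ ⟨hy, hyr⟩ α γ hα hγ hαγ
  dsimp only at hx hxs hy hyr
  refine ⟨by simp [hx, hy, ← add_mul, hαγ], ?_⟩
  have h1 : 0 ≤ R (x - y) := hR _ (by simp [hx, hy])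
  have h2 : R (x - y) = R x - QuadraticMap.polar R x y + R y := by
    have := quadraticForm_add_smul R x y (-1)
    simpa [sub_eq_add_neg] using this
  have h3 : R (α • x + γ • y) = α * R x + γ * R y - α * γ * R (x - y) := by
    rw [quadraticForm_add_smul, QuadraticMap.map_smul, QuadraticMap.polar_smul_left, h2]
    simp only [smul_eq_mul]
    obtain rfl : γ = 1 - α := by linarith
    ring
  simp only [Prod.smul_mk, Prod.mk_add_mk, h3, smul_eq_mul]
  nlinarith [mul_nonneg (mul_nonneg hα hγ) h1, mul_le_mul_of_nonneg_left hxs hα,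
    mul_le_mul_of_nonneg_left hyr hγ]

/-- A quadratic form that is nonnegative on the open cone cut by `0 ≤ h` and on the kernel of `h`
dominates `h * W` for some functional `W` in the dual cone. By homogeneity this only has to be
arranged on the hyperplane `h = 1`, where the form is convex and Hahn–Banach applies. -/
theorem exists_dual_functional (R : QuadraticForm ℝ (ℝ × E)) (h : ℝ × E →ₗ[ℝ] ℝ)
    (hcone : ∀ z : ℝ × E, ‖z.2‖ < z.1 → 0 ≤ h z → 0 ≤ R z) (hker : ∀ z, h z = 0 → 0 ≤ R z)
    {z₀ : ℝ × E} (hz₀ : ‖z₀.2‖ < z₀.1) (hhz₀ : 0 < h z₀) :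
    ∃ W : ℝ × E →L[ℝ] ℝ, (∀ z : ℝ × E, ‖z.2‖ < z.1 → 0 ≤ W z) ∧ ∀ z, h z * W z ≤ R z := by
  let C : Set (ℝ × (ℝ × E)) := Set.Iio 0 ×ˢ {z : ℝ × E | ‖z.2‖ < z.1}
  let M : Set (ℝ × (ℝ × E)) := {p | h p.2 = 1 ∧ R p.2 ≤ p.1}
  have hdisj : Disjoint C M := by
    rw [Set.disjoint_left]
    rintro ⟨s, z⟩ ⟨hs, hz⟩ ⟨h1, h2⟩
    have := hcone z hz (h1 ▸ zero_le_one)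
    simp only [Set.mem_Iio] at hs h2
    linarith
  obtain ⟨f, v, hfC, hfM⟩ := geometric_hahn_banach_open
    ((convex_Iio 0).prod convex_openLorentzCone) (isOpen_Iio.prod (isOpen_lt (by fun_prop) (by fun_prop)))
    (convex_epigraph_of_nonneg_on_ker R h hker 1) hdisj
  have hsplit : ∀ s z, f (s, z) = s * f (1, 0) + f (0, z) := by
    intro s z
    have : ((s, z) : ℝ × (ℝ × E)) = s • (1, 0) + (0, z) := by simp
    rw [this, map_add, map_smul, smul_eq_mul]
  have hscale : ∀ s z, s < 0 → ‖z.2‖ < z.1 → ∀ k : ℝ, 0 < k → k * f (s, z) < v := by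
    intro s z hs hz k hk
    have := hfC (k • (s, z)) ⟨by simpa using mul_neg_of_pos_of_neg hk hs, by
      simpa [norm_smul, abs_of_pos hk] using mul_lt_mul_of_pos_left hz hk⟩
    rwa [map_smul, smul_eq_mul] at this
  have hCnonpos : ∀ s z, s < 0 → ‖z.2‖ < z.1 → f (s, z) ≤ 0 := by
    intro s z hs hz
    by_contra! hpos
    have h1 := hscale s z hs hz ((|v| + 1) / f (s, z)) (by positivity)
    rw [div_mul_cancel₀ _ hpos.ne'] at h1
    linarith [le_abs_self v]
  have hv : 0 ≤ v := by
    have h1 := hscale (-1) z₀ (by norm_num) hz₀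
    by_contra! hneg
    have h2 := hCnonpos (-1) z₀ (by norm_num) hz₀
    rcases h2.eq_or_lt with h3 | h3
    · have := h1 1 one_pos
      rw [h3] at this
      linarith
    · have := h1 (v / (2 * f (-1, z₀))) (div_pos_of_neg_of_neg hneg (by linarith))
      rw [div_mul_eq_mul_div, mul_div_mul_right _ _ h3.ne] at this
      linarith
  -- The point of the cut cone on the hyperplane `h = 1` forces a nonvertical separation.
  have hμ : 0 < f (1, 0) := by
    set z₁ := (h z₀)⁻¹ • z₀ with hz₁
    have hi : 0 < (h z₀)⁻¹ := inv_pos.mpr hhz₀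
    have hh : h z₁ = 1 := by simp [hz₁, hhz₀.ne']
    have hL : ‖z₁.2‖ < z₁.1 := by
      simpa [hz₁, norm_smul, abs_of_pos hhz₀] using mul_lt_mul_of_pos_left hz₀ hi
    have h1 := hfC (-1, z₁) ⟨by simp, hL⟩
    have h2 := hfM (R z₁, z₁) ⟨hh, le_rfl⟩
    rw [hsplit] at h1 h2
    have h3 := hcone z₁ hL (hh ▸ zero_le_one)
    nlinarith
  set μ := f (1, 0)
  let W : ℝ × E →L[ℝ] ℝ := -(μ⁻¹ • f.comp (ContinuousLinearMap.inr ℝ ℝ (ℝ × E)))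
  have hW : ∀ z, μ * W z = -f (0, z) := by
    intro z
    simp [W, hμ.ne']
  refine ⟨W, fun z hz => ?_, fun z => ?_⟩
  · refine nonneg_of_mul_nonneg_right (a := μ) ?_ hμ
    rw [hW]
    refine neg_nonneg.mpr (le_of_forall_pos_le_add fun ε hε => ?_)
    have h1 := hCnonpos (-(ε / μ)) z (neg_neg_of_pos (div_pos hε hμ)) hz
    rw [hsplit, neg_mul, div_mul_cancel₀ _ hμ.ne'] at h1
    linarith
  · rcases eq_or_ne (h z) 0 with hz | hz
    · simpa [hz] using hker z hz
    set y := (h z)⁻¹ • z with hy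
    have hzy : z = h z • y := by rw [hy, smul_inv_smul₀ hz]
    have h1 := hfM (R y, y) ⟨by simp [hy, hz], le_rfl⟩
    rw [hsplit] at h1
    have h2 : W y ≤ R y := le_of_mul_le_mul_left (by rw [hW]; linarith) hμ
    have h3 : W z = h z * W y := by
      conv_lhs => rw [hzy]
      simp
    have h4 : R z = h z * h z * R y := by
      conv_lhs => rw [hzy]
      rw [QuadraticMap.map_smul, smul_eq_mul]
    rw [h3, h4, ← mul_assoc]
    exact mul_le_mul_of_nonneg_left h2 (mul_self_nonneg _)

/-- A quadratic form is nonnegative on the Lorentz cone cut by `0 ≤ h` only if it dominates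
`lam * J + h * W`, with `J` the Lorentz form, `0 ≤ lam`, and `W` in the dual cone. -/
theorem exists_lorentz_certificate (Q : QuadraticForm ℝ (ℝ × E)) (h : ℝ × E →ₗ[ℝ] ℝ)
    (hQ : ∀ z : ℝ × E, ‖z.2‖ ≤ z.1 → 0 ≤ h z → 0 ≤ Q z)
    {z₀ : ℝ × E} (hz₀ : ‖z₀.2‖ < z₀.1) (hhz₀ : 0 < h z₀) :
    ∃ (lam : ℝ) (W : ℝ × E →L[ℝ] ℝ), 0 ≤ lam ∧ (∀ z : ℝ × E, ‖z.2‖ < z.1 → 0 ≤ W z) ∧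
      ∀ z, lam * (z.1 ^ 2 - ‖z.2‖ ^ 2) + h z * W z ≤ Q z := by
  obtain ⟨lam, hlam, hcone, hker⟩ := exists_lorentz_multiplier Q h hQ hz₀ hhz₀.le
  obtain ⟨W, hW, hle⟩ := exists_dual_functional (Q - lam • lorentzForm E) h
    (fun z hz hhz => by simpa using hcone z hz hhz) (fun z hz => by simpa using hker z hz)
    hz₀ hhz₀
  refine ⟨lam, W, hlam, hW, fun z => ?_⟩
  have := hle z
  simp only [sub_apply, smul_apply, lorentzForm_apply,
    smul_eq_mul] at this
  linarith

end Lorentz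

/-! ### The extended trust region subproblem -/

theorem euclNorm_sq {n : ℕ} (x : Fin n → ℝ) : euclNorm x ^ 2 = x ⬝ᵥ x := by
  rw [euclNorm, ← real_inner_self_eq_norm_sq, EuclideanSpace.inner_toLp_toLp, star_trivial]

theorem euclNorm_nonneg {n : ℕ} (x : Fin n → ℝ) : 0 ≤ euclNorm x := norm_nonneg _

theorem neg_euclNorm_mul_le_dotProduct {n : ℕ} (u x : Fin n → ℝ) :
    -(euclNorm u * euclNorm x) ≤ u ⬝ᵥ x := by
  have h := (abs_le.mp (abs_real_inner_le_norm (WithLp.toLp 2 u) (WithLp.toLp 2 x))).1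
  rwa [EuclideanSpace.inner_toLp_toLp, star_trivial, dotProduct_comm] at h

theorem cons_mem_lorentzCone {n : ℕ} (t : ℝ) (u : Fin n → ℝ) :
    (Fin.cons t u : Fin (n + 1) → ℝ) ∈ lorentzCone n ↔ euclNorm u ≤ t := by
  simp [lorentzCone]

theorem etrsHessian_mulVec {n : ℕ} (A : Matrix (Fin n) (Fin n) ℝ) (b : Fin n → ℝ) (lam₀ : ℝ)
    (u x : Fin n → ℝ) :
    etrsHessian A b lam₀ u *ᵥ x =
      (2 : ℝ) • (A *ᵥ x) + (2 * lam₀) • x + (u ⬝ᵥ x) • b + (b ⬝ᵥ x) • u := by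
  simp [etrsHessian, Matrix.add_mulVec, Matrix.smul_mulVec, Matrix.vecMulVec_mulVec]

theorem dotProduct_etrsHessian_mulVec {n : ℕ} (A : Matrix (Fin n) (Fin n) ℝ) (b : Fin n → ℝ)
    (lam₀ : ℝ) (u x : Fin n → ℝ) :
    x ⬝ᵥ (etrsHessian A b lam₀ u *ᵥ x) =
      2 * (x ⬝ᵥ (A *ᵥ x)) + 2 * lam₀ * (x ⬝ᵥ x) + 2 * ((b ⬝ᵥ x) * (u ⬝ᵥ x)) := by
  rw [etrsHessian_mulVec]
  simp only [dotProduct_add, dotProduct_smul, smul_eq_mul, dotProduct_comm x b,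
    dotProduct_comm x u]
  ring

theorem isHermitian_etrsHessian {n : ℕ} {A : Matrix (Fin n) (Fin n) ℝ} (hA : A.IsSymm)
    (b : Fin n → ℝ) (lam₀ : ℝ) (u : Fin n → ℝ) : (etrsHessian A b lam₀ u).IsHermitian := by
  rw [Matrix.IsHermitian, Matrix.conjTranspose_eq_transpose_of_trivial, etrsHessian]
  simp only [Matrix.transpose_add, Matrix.transpose_smul, Matrix.transpose_one,
    Matrix.transpose_vecMulVec, hA.eq]
  abel

/-- The Lagrangian in which the linear constraint has the affine multiplier `uᵀ x - u₀`. -/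
noncomputable def etrsLagrangian {n : ℕ} (A : Matrix (Fin n) (Fin n) ℝ) (a b : Fin n → ℝ) (β lam₀ u₀ : ℝ)
    (u x : Fin n → ℝ) : ℝ :=
  etrsObjective A a x + lam₀ * (euclNorm x ^ 2 - 1) + (u ⬝ᵥ x - u₀) * (b ⬝ᵥ x - β)

theorem etrsLagrangian_add {n : ℕ} {A : Matrix (Fin n) (Fin n) ℝ} (hA : A.IsSymm)
    (a b : Fin n → ℝ) (β lam₀ u₀ : ℝ) (u x d : Fin n → ℝ) :
    etrsLagrangian A a b β lam₀ u₀ u (x + d) = etrsLagrangian A a b β lam₀ u₀ u x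
      + d ⬝ᵥ (etrsHessian A b lam₀ u *ᵥ x + ((2 : ℝ) • a - β • u - u₀ • b))
      + d ⬝ᵥ (etrsHessian A b lam₀ u *ᵥ d) / 2 := by
  have hsymm : x ⬝ᵥ (A *ᵥ d) = d ⬝ᵥ (A *ᵥ x) := by
    rw [Matrix.dotProduct_mulVec, ← Matrix.mulVec_transpose, hA.eq, dotProduct_comm]
  rw [dotProduct_etrsHessian_mulVec, etrsHessian_mulVec]
  simp only [etrsLagrangian, etrsObjective, euclNorm_sq, Matrix.mulVec_add, dotProduct_add,
    add_dotProduct, dotProduct_smul, dotProduct_sub, smul_eq_mul, hsymm, dotProduct_comm d a,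
    dotProduct_comm d b, dotProduct_comm d u, dotProduct_comm d x]
  ring

/-- On the feasible set, both multiplier terms of the Lagrangian are nonpositive. -/
theorem lagrangian_terms_nonpos {n : ℕ} {b u x : Fin n → ℝ} {β lam₀ u₀ : ℝ} (hlam : 0 ≤ lam₀)
    (hu : euclNorm u ≤ -u₀) (hx : x ∈ etrsFeasible b β) :
    lam₀ * (euclNorm x ^ 2 - 1) ≤ 0 ∧ (u ⬝ᵥ x - u₀) * (b ⬝ᵥ x - β) ≤ 0 := by
  obtain ⟨h1, h2⟩ := hx
  refine ⟨mul_nonpos_of_nonneg_of_nonpos hlam (by linarith),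
    mul_nonpos_of_nonneg_of_nonpos ?_ (by linarith)⟩
  have h3 : euclNorm x ≤ 1 := by nlinarith [euclNorm_nonneg x]
  have h4 := neg_euclNorm_mul_le_dotProduct u x
  nlinarith [mul_le_mul_of_nonneg_left h3 (euclNorm_nonneg u)]

/-- The homogenization `(t, x) ↦ xᵀ A x + 2 t aᵀ x - m t²` of the objective minus `m`.
The bilinear map it comes from is not symmetric; only its diagonal matters. -/
noncomputable def etrsHomogenized {n : ℕ} (A : Matrix (Fin n) (Fin n) ℝ) (a : Fin n → ℝ) (m : ℝ) :
    QuadraticForm ℝ (ℝ × EuclideanSpace ℝ (Fin n)) :=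
  LinearMap.BilinMap.toQuadraticMap <| LinearMap.mk₂ ℝ
    (fun z w => z.2.ofLp ⬝ᵥ (A *ᵥ w.2.ofLp) + 2 * z.1 * (a ⬝ᵥ w.2.ofLp) - m * (z.1 * w.1))
    (fun _ _ _ => by
      simp only [Prod.fst_add, Prod.snd_add, WithLp.ofLp_add, add_dotProduct]; ring)
    (fun _ _ _ => by
      simp only [Prod.smul_fst, Prod.smul_snd, WithLp.ofLp_smul, smul_dotProduct,
        smul_eq_mul]; ring)
    (fun _ _ _ => by
      simp only [Prod.fst_add, Prod.snd_add, WithLp.ofLp_add, Matrix.mulVec_add,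
        dotProduct_add]; ring)
    (fun _ _ _ => by
      simp only [Prod.smul_fst, Prod.smul_snd, WithLp.ofLp_smul, Matrix.mulVec_smul,
        dotProduct_smul, smul_eq_mul]; ring)

theorem etrsHomogenized_apply {n : ℕ} (A : Matrix (Fin n) (Fin n) ℝ) (a : Fin n → ℝ) (m : ℝ)
    (z : ℝ × EuclideanSpace ℝ (Fin n)) :
    etrsHomogenized A a m z =
      z.2.ofLp ⬝ᵥ (A *ᵥ z.2.ofLp) + 2 * z.1 * (a ⬝ᵥ z.2.ofLp) - m * (z.1 * z.1) := rfl

/-- The homogenization `(t, x) ↦ β t - bᵀ x` of the slack of the linear constraint. -/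
noncomputable def etrsSlack {n : ℕ} (b : Fin n → ℝ) (β : ℝ) :
    ℝ × EuclideanSpace ℝ (Fin n) →ₗ[ℝ] ℝ where
  toFun z := β * z.1 - b ⬝ᵥ z.2.ofLp
  map_add' _ _ := by
    simp only [Prod.fst_add, Prod.snd_add, WithLp.ofLp_add, dotProduct_add]; ring
  map_smul' _ _ := by
    simp only [Prod.smul_fst, Prod.smul_snd, WithLp.ofLp_smul, dotProduct_smul, smul_eq_mul,
      RingHom.id_apply]; ring

theorem etrsSlack_apply {n : ℕ} (b : Fin n → ℝ) (β : ℝ) (z : ℝ × EuclideanSpace ℝ (Fin n)) :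
    etrsSlack b β z = β * z.1 - b ⬝ᵥ z.2.ofLp := rfl

theorem etrsHomogenized_nonneg {n : ℕ} {A : Matrix (Fin n) (Fin n) ℝ} {a b : Fin n → ℝ}
    {β m : ℝ} (hm : ∀ x ∈ etrsFeasible b β, m ≤ etrsObjective A a x)
    (z : ℝ × EuclideanSpace ℝ (Fin n)) (hz : ‖z.2‖ ≤ z.1) (hhz : 0 ≤ etrsSlack b β z) :
    0 ≤ etrsHomogenized A a m z := by
  obtain ⟨t, x⟩ := z
  dsimp only at hz
  rcases ((norm_nonneg x).trans hz).eq_or_lt with rfl | ht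
  · simp [norm_le_zero_iff.mp hz, etrsHomogenized_apply]
  have hx : ((t, x) : ℝ × EuclideanSpace ℝ (Fin n)) = t • (1, t⁻¹ • x) := by
    simp [smul_inv_smul₀ ht.ne']
  rw [hx] at hhz ⊢
  rw [map_smul, smul_eq_mul, mul_nonneg_iff_of_pos_left ht, etrsSlack_apply] at hhz
  rw [QuadraticMap.map_smul, smul_eq_mul]
  refine mul_nonneg (mul_self_nonneg t) ?_
  have hn : ‖t⁻¹ • x‖ ≤ 1 := by
    rw [norm_smul, Real.norm_of_nonneg (inv_nonneg.mpr ht.le)]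
    exact inv_mul_le_one_of_le₀ hz ht.le
  have h1 := hm (t⁻¹ • x).ofLp ⟨pow_le_one₀ (norm_nonneg _) hn, by simpa using hhz⟩
  rw [etrsObjective] at h1
  rw [etrsHomogenized_apply]
  linarith

/-- A functional that is nonnegative on the open Lorentz cone is represented by a vector of the
cone. -/
theorem exists_eq_of_nonneg_on_lorentzCone {n : ℕ} (W : ℝ × EuclideanSpace ℝ (Fin n) →L[ℝ] ℝ)
    (hW : ∀ z : ℝ × EuclideanSpace ℝ (Fin n), ‖z.2‖ < z.1 → 0 ≤ W z) :
    ∃ (w : ℝ) (u : Fin n → ℝ), euclNorm u ≤ w ∧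
      ∀ (t : ℝ) (x : Fin n → ℝ), W (t, WithLp.toLp 2 x) = w * t + u ⬝ᵥ x := by
  set v := (InnerProductSpace.toDual ℝ (EuclideanSpace ℝ (Fin n))).symm
    (W.comp (ContinuousLinearMap.inr ℝ ℝ _)) with hv
  have hv_inner : ∀ x, W (0, x) = inner ℝ v x := fun x => by
    rw [hv, InnerProductSpace.toDual_symm_apply]
    simp
  have hsplit : ∀ t x, W (t, x) = W (1, 0) * t + inner ℝ v x := by
    intro t x
    have : ((t, x) : ℝ × EuclideanSpace ℝ (Fin n)) = t • (1, 0) + (0, x) := by simp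
    rw [this, map_add, map_smul, hv_inner, smul_eq_mul, mul_comm]
  have hw : 0 ≤ W (1, 0) := hW _ (by simp)
  refine ⟨W (1, 0), v.ofLp, ?_, fun t x => ?_⟩
  · change ‖v‖ ≤ W (1, 0)
    by_contra! hlt
    have hpos : 0 < ‖v‖ := hw.trans_lt hlt
    -- For `t` slightly larger than `‖v‖`, the functional is negative at `(t, -v)`.
    have h1 := hW (‖v‖ + (‖v‖ - W (1, 0)) / 2, -v) (by simp; linarith)
    rw [hsplit, inner_neg_right, real_inner_self_eq_norm_sq] at h1
    nlinarith
  · rw [hsplit, EuclideanSpace.inner_eq_star_dotProduct, star_trivial, dotProduct_comm]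

theorem theorem2p1 (n : ℕ) (A : Matrix (Fin n) (Fin n) ℝ) (hA : A.IsSymm)
    (a b : Fin n → ℝ) (β : ℝ)
    (hslater : ∃ xhat : Fin n → ℝ, euclNorm xhat ^ 2 - 1 < 0 ∧ b ⬝ᵥ xhat - β < 0)
    (xstar : Fin n → ℝ) (hfeas : xstar ∈ etrsFeasible b β) :
    IsMinOn (etrsObjective A a) (etrsFeasible b β) xstar ↔
      ∃ (lam₀ u₀ : ℝ) (u : Fin n → ℝ),
        0 ≤ lam₀ ∧
        (Fin.cons (-u₀) u : Fin (n + 1) → ℝ) ∈ lorentzCone n ∧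
        etrsHessian A b lam₀ u *ᵥ xstar = -((2 : ℝ) • a - β • u - u₀ • b) ∧
        lam₀ * (euclNorm xstar ^ 2 - 1) = 0 ∧
        (u ⬝ᵥ xstar - u₀) * (b ⬝ᵥ xstar - β) = 0 ∧
        (etrsHessian A b lam₀ u).PosSemidef := by
  constructor
  · intro hmin
    obtain ⟨xhat, hxhat, hbxhat⟩ := hslater
    have hnorm : ‖(WithLp.toLp 2 xhat : EuclideanSpace ℝ (Fin n))‖ < 1 :=
      (sq_lt_one_iff₀ (norm_nonneg _)).mp (by simpa [euclNorm] using hxhat)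
    obtain ⟨lam₀, W, hlam, hW, hle⟩ := exists_lorentz_certificate
      (etrsHomogenized A a (etrsObjective A a xstar)) (etrsSlack b β)
      (etrsHomogenized_nonneg fun x hx => hmin hx) (z₀ := (1, WithLp.toLp 2 xhat)) hnorm
      (by rw [etrsSlack_apply]; dsimp only; linarith)
    obtain ⟨w, u, hu, hWeq⟩ := exists_eq_of_nonneg_on_lorentzCone W hW
    have hle' : ∀ (t : ℝ) (x : Fin n → ℝ),
        lam₀ * (t ^ 2 - x ⬝ᵥ x) + (β * t - b ⬝ᵥ x) * (w * t + u ⬝ᵥ x) ≤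
          x ⬝ᵥ (A *ᵥ x) + 2 * t * (a ⬝ᵥ x) - etrsObjective A a xstar * (t * t) := by
      intro t x
      rw [← euclNorm_sq, ← hWeq]
      exact hle (t, WithLp.toLp 2 x)
    -- The slice `t = 1` bounds the Lagrangian from below by the minimum value.
    have hlag : ∀ x, etrsObjective A a xstar ≤ etrsLagrangian A a b β lam₀ (-w) u x := by
      intro x
      have := hle' 1 x
      rw [etrsLagrangian, euclNorm_sq]
      conv_rhs => rw [etrsObjective]
      linarith
    have hterms := lagrangian_terms_nonpos (u₀ := -w) hlam (by rwa [neg_neg]) hfeas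
    have hstar := hlag xstar
    rw [etrsLagrangian] at hstar
    have hc1 : lam₀ * (euclNorm xstar ^ 2 - 1) = 0 := by linarith [hterms.1, hterms.2]
    have hc2 : (u ⬝ᵥ xstar - -w) * (b ⬝ᵥ xstar - β) = 0 := by linarith [hterms.1, hterms.2]
    refine ⟨lam₀, -w, u, hlam, by rwa [cons_mem_lorentzCone, neg_neg], ?_, hc1, hc2, ?_⟩
    · rw [eq_neg_iff_add_eq_zero]
      -- `xstar` minimizes the Lagrangian, whose restrictions to lines are quadratic polynomials.
      refine dotProduct_eq_zero _ fun d => ?_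
      rw [dotProduct_comm]
      have hdisc := discrim_le_zero (K := ℝ) (c := 0)
        (a := d ⬝ᵥ (etrsHessian A b lam₀ u *ᵥ d) / 2)
        (b := d ⬝ᵥ (etrsHessian A b lam₀ u *ᵥ xstar + ((2 : ℝ) • a - β • u - (-w) • b)))
        (fun s => by
          have h1 := hlag (xstar + s • d)
          rw [etrsLagrangian_add hA, etrsLagrangian, hc1, hc2, Matrix.mulVec_smul,
            smul_dotProduct, smul_dotProduct, dotProduct_smul] at h1
          simp only [smul_eq_mul] at h1
          linarith)
      rw [discrim, mul_zero, sub_zero] at hdisc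
      exact pow_eq_zero_iff two_ne_zero |>.mp (le_antisymm hdisc (sq_nonneg _))
    · -- The slice `t = 0` of the certificate is half the Hessian form.
      refine Matrix.PosSemidef.of_dotProduct_mulVec_nonneg
        (isHermitian_etrsHessian hA b lam₀ u) fun x => ?_
      rw [star_trivial, dotProduct_etrsHessian_mulVec]
      have := hle' 0 x
      linarith
  · rintro ⟨lam₀, u₀, u, hlam, hu, hgrad, hc1, hc2, hpsd⟩
    rw [cons_mem_lorentzCone] at hu
    intro x hx
    have hterms := lagrangian_terms_nonpos hlam hu hx
    have hexp := etrsLagrangian_add hA a b β lam₀ u₀ u xstar (x - xstar)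
    rw [hgrad, neg_add_cancel, dotProduct_zero, add_sub_cancel, etrsLagrangian,
      etrsLagrangian, hc1, hc2] at hexp
    have hq := hpsd.dotProduct_mulVec_nonneg (x - xstar)
    rw [star_trivial] at hq
    change etrsObjective A a xstar ≤ etrsObjective A a x
    linarith [hterms.1, hterms.2]
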